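/- Let $X_1,X_2,\dots$ be i.i.d. real random variables with law $\mu$, where $\int_{\mathbb R}|x|\,\mu(dx)<\infty$, and let $\mu_n=\frac1n\sum_{i=1}^n\delta_{X_i}$ be the empirical measure. Let $W_1(\pi_1,\pi_2)=\inf_\pi\int|x-y|\,d\pi(x,y)$ be the $1$-Wasserstein distance, the infimum being over all couplings $\pi$ of $\pi_1$ and $\pi_2$. Let $U$ be uniform on $[0,1]$; for $G:[0,1]\to\mathbb R$ continuous let $G_{\sharp U}$ be the law of $G(U)$. For $K>0$ let $\mathrm{Lip}_K([0,1],\mathbb R)$ be the set of $K$-Lipschitz functions $[0,1]\to\mathbb R$, and for each $n\ge 1$ let $\widehat G_K=\widehat G_{K,n}\in \mathrm{Lip}_K([0,1],\mathbb R)$ be any (data-dependent) minimizer of the WGAN problem, i.e. $$W_1(\widehat G_{K\sharp U},\mu_n)=\inf_{G\in \mathrm{Lip}_K([0,1],\mathbb R)}W_1(G_{\sharp U},\mu_n).$$ Let $F$ be the distribution function of $\mu$, let $F^{-1}(u)=\inf\{x\in\mathbb R: F(x)\ge u\}$ for $u\in(0,1)$, and let $S(\mu)$ be the support of $\mu$.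 1. Assume that $S(\mu)$ is bounded. (i) If $F^{-1}$ is $K_0$-Lipschitz on $(0,1)$ (equivalently, extends to a $K_0$-Lipschitz function on $[0,1]$) for some $K_0>0$, then for all $K\ge K_0$, $\lim_{n\to\infty}W_1(\widehat G_{K\sharp U},\mu)=0$ almost surely. (ii) If $F$ is $K_1$-Lipschitz on $\mathbb R$ for some $K_1>0$, then for all $0<K<1/K_1$, $\liminf_{n\to\infty}W_1(\widehat G_{K\sharp U},\mu)>0$ almost surely. 2. Assume that $S(\mu)$ is unbounded. Then for all $K>0$, $\liminf_{n\to\infty}W_1(\widehat G_{K\sharp U},\mu)>0$ almost surely. -/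

import Mathlib

open MeasureTheory ProbabilityTheory Filter Topology Set
open scoped NNReal ENNReal unitInterval

noncomputable section

/-- The set of couplings of two measures: the measures on the product space whose two
marginals are the given measures. -/
def couplings {E : Type*} [MeasurableSpace E] (ν₁ ν₂ : Measure E) : Set (Measure (E × E)) :=
  {γ | γ.fst = ν₁ ∧ γ.snd = ν₂}

/-- The `1`-Wasserstein distance (primal form), with values in `[0, ∞]`. -/
def W1 {E : Type*} [PseudoEMetricSpace E] [MeasurableSpace E] (ν₁ ν₂ : Measure E) : ℝ≥0∞ :=
  ⨅ γ ∈ couplings ν₁ ν₂, ∫⁻ p, edist p.1 p.2 ∂γ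

/-- The empirical measure of the first `n` terms `x 0, …, x (n - 1)` of a sequence
(meaningful for `1 ≤ n`). -/
def empiricalMeasure {E : Type*} [MeasurableSpace E] (x : ℕ → E) (n : ℕ) : Measure E :=
  (n : ℝ≥0∞)⁻¹ • ∑ i ∈ Finset.range n, Measure.dirac (x i)

/-- `Lip_K([0,1], ℝ)`. -/
def lipClass (K : ℝ≥0) : Set (I → ℝ) := {G | LipschitzWith K G}

/-- The law of `G(U)` where `U` is uniform on `[0,1]`. -/
def pushUnif (G : I → ℝ) : Measure ℝ := Measure.map G (volume : Measure I)

/-- The set of minimizers of `G ↦ W₁(G_♯U, ν)` over `Lip_K([0,1], ℝ)`. -/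
def wganMinimizers (K : ℝ≥0) (ν : Measure ℝ) : Set (I → ℝ) :=
  {G | G ∈ lipClass K ∧ W1 (pushUnif G) ν = ⨅ G' ∈ lipClass K, W1 (pushUnif G') ν}

/-- The generalized inverse `F⁻¹(u) = inf {x | F x ≥ u}` of the distribution function `F` of `μ`
(to be used for `u ∈ (0,1)` only, where the set is non-empty and bounded below). -/
def quantileFn (μ : Measure ℝ) (u : ℝ) : ℝ := sInf {x : ℝ | u ≤ cdf μ x}

end

/-!
The bound from above rests on the triangle inequality for `W1` (`W1_triangle`, by gluing couplings
through conditional laws). If `F⁻¹` is `K₀`-Lipschitz, its extension to `[0,1]` is an admissible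
generator whose law is `μ` itself, so a minimizer is within `2 W₁(μₙ, μ)` of `μ`
(`W1_pushUnif_le_of_mem_wganMinimizers`). For bounded support `W₁(μₙ, μ)` is bounded by
the cost `∫₀¹ |Fₙ⁻¹ - F⁻¹|` of the quantile coupling. The strong law gives `Fₙ → F` at all rationals
almost surely; as `F⁻¹` is continuous, `Fₙ⁻¹ → F⁻¹` pointwise, and dominated convergence applies.

The bounds from below hold uniformly over `Lip_K`, hence along every choice of generators: a `K`-Lipschitz
generator charges only an interval of length `K`, and mass of `μ` at distance `ε` from that interval
costs at least `ε` per unit (`mul_measure_le_W1`). When `F` is `K₁`-Lipschitz, an interval of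
length `K + 2ε` has mass at most `K₁ (K + 2ε) < 1` for small `ε`. When the support is unbounded,
there are two sets of positive mass that no interval of length `K` can approach simultaneously.
-/

/-! ### The Wasserstein distance -/

/-- Two couplings with a common marginal are glued along it: given the middle point, the third
point is drawn from the conditional law of the second coupling. -/
lemma exists_gluing {E : Type*} [MeasurableSpace E] [StandardBorelSpace E] [Nonempty E]
    {ν₁ ν₂ ν₃ : Measure E} [IsFiniteMeasure ν₂]
    {γ₁ γ₂ : Measure (E × E)} (h₁ : γ₁ ∈ couplings ν₁ ν₂) (h₂ : γ₂ ∈ couplings ν₂ ν₃) :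
    ∃ η : Measure ((E × E) × E), η.map Prod.fst = γ₁ ∧ η.map (fun p => (p.1.2, p.2)) = γ₂ := by
  have hγ₁ : IsFiniteMeasure γ₁ := by
    refine ⟨?_⟩
    rw [← Measure.snd_univ, h₁.2]
    exact measure_lt_top _ _
  have hγ₂ : IsFiniteMeasure γ₂ := by
    refine ⟨?_⟩
    rw [← Measure.fst_univ, h₂.1]
    exact measure_lt_top _ _
  refine ⟨γ₁ ⊗ₘ (γ₂.condKernel.comap Prod.snd measurable_snd), ?_, ?_⟩
  · exact Measure.fst_compProd _ _
  · conv_rhs => rw [← γ₂.disintegrate γ₂.condKernel, h₂.1, ← h₁.2]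
    refine Measure.ext_of_lintegral _ fun f hf => ?_
    rw [lintegral_map hf (by fun_prop), Measure.lintegral_compProd (by fun_prop),
      Measure.lintegral_compProd hf, Measure.snd, lintegral_map _ measurable_snd]
    · rfl
    · exact hf.lintegral_kernel_prod_right'

section Wasserstein

variable {E : Type*} [PseudoEMetricSpace E] [MeasurableSpace E]

lemma W1_le_of_mem_couplings {ν₁ ν₂ : Measure E} {γ : Measure (E × E)} (h : γ ∈ couplings ν₁ ν₂) :
    W1 ν₁ ν₂ ≤ ∫⁻ p, edist p.1 p.2 ∂γ :=
  iInf₂_le γ h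

/-- Mass of the target lying at distance at least `ε` from a carrier of the source has to be
transported at cost at least `ε`. -/
lemma mul_measure_le_W1 {ν μ : Measure E} {s t : Set E} {ε : ℝ≥0∞} (hs : ∀ᵐ x ∂ν, x ∈ s)
    (ht : MeasurableSet t) (h : ∀ x ∈ s, ∀ y ∈ t, ε ≤ edist x y) : ε * μ t ≤ W1 ν μ := by
  refine le_iInf₂ fun γ ⟨h₁, h₂⟩ => ?_
  have hs' : ∀ᵐ p ∂γ, p.1 ∈ s := by
    rw [← h₁] at hs
    exact ae_of_ae_map measurable_fst.aemeasurable hs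
  calc ε * μ t = ε * γ (Prod.snd ⁻¹' t) := by rw [← h₂, Measure.snd_apply ht]
    _ = ∫⁻ p, (Prod.snd ⁻¹' t).indicator (fun _ => ε) p ∂γ :=
      (lintegral_indicator_const (measurable_snd ht) ε).symm
    _ ≤ ∫⁻ p, edist p.1 p.2 ∂γ := by
      refine lintegral_mono_ae ?_
      filter_upwards [hs'] with p hp
      by_cases hpt : p ∈ Prod.snd ⁻¹' t
      · rw [indicator_of_mem hpt]
        exact h _ hp _ hpt
      · simp [indicator_of_notMem hpt]

variable [OpensMeasurableSpace E] [SecondCountableTopology E]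

lemma W1_map_le {α : Type*} [MeasurableSpace α] {m : Measure α} {f g : α → E}
    (hf : AEMeasurable f m) (hg : AEMeasurable g m) :
    W1 (m.map f) (m.map g) ≤ ∫⁻ a, edist (f a) (g a) ∂m := by
  have hfg : AEMeasurable (fun a => (f a, g a)) m := hf.prodMk hg
  refine (W1_le_of_mem_couplings (γ := m.map fun a => (f a, g a)) ⟨?_, ?_⟩).trans_eq ?_
  · rw [Measure.fst, AEMeasurable.map_map_of_aemeasurable measurable_fst.aemeasurable hfg]
    rfl
  · rw [Measure.snd, AEMeasurable.map_map_of_aemeasurable measurable_snd.aemeasurable hfg]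
    rfl
  · exact lintegral_map' (measurable_fst.edist measurable_snd).aemeasurable hfg

lemma W1_comm_le (ν₁ ν₂ : Measure E) : W1 ν₁ ν₂ ≤ W1 ν₂ ν₁ := by
  refine le_iInf₂ fun γ ⟨h₁, h₂⟩ => ?_
  have h := W1_map_le (m := γ) measurable_snd.aemeasurable measurable_fst.aemeasurable
  change W1 γ.snd γ.fst ≤ _ at h
  simpa only [h₁, h₂, edist_comm] using h

lemma W1_comm (ν₁ ν₂ : Measure E) : W1 ν₁ ν₂ = W1 ν₂ ν₁ :=
  (W1_comm_le _ _).antisymm (W1_comm_le _ _)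

lemma W1_triangle [StandardBorelSpace E] [Nonempty E] (ν₁ ν₂ ν₃ : Measure E) [IsFiniteMeasure ν₂] :
    W1 ν₁ ν₃ ≤ W1 ν₁ ν₂ + W1 ν₂ ν₃ := by
  simp only [W1, ENNReal.iInf_add, ENNReal.add_iInf]
  refine le_iInf₂ fun γ₂ h₂ => le_iInf₂ fun γ₁ h₁ => ?_
  obtain ⟨η, rfl, rfl⟩ := exists_gluing h₁ h₂
  have e₁ : ν₁ = η.map (fun p => p.1.1) := by
    rw [← h₁.1, Measure.fst, Measure.map_map measurable_fst measurable_fst]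
    rfl
  have e₃ : ν₃ = η.map (fun p => p.2) := by
    rw [← h₂.2, Measure.snd, Measure.map_map measurable_snd (by fun_prop)]
    rfl
  have h := W1_map_le (m := η) (f := fun p => p.1.1) (g := fun p => p.2) (by fun_prop)
    (by fun_prop)
  rw [← e₁, ← e₃] at h
  refine h.trans ?_
  rw [lintegral_map (measurable_fst.edist measurable_snd) measurable_fst,
    lintegral_map (measurable_fst.edist measurable_snd) (by fun_prop),
    ← lintegral_add_left ((by fun_prop : Measurable fun p : (E × E) × E => p.1.1).edist
      (by fun_prop : Measurable fun p : (E × E) × E => p.1.2))]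
  exact lintegral_mono fun p => edist_triangle _ _ _

end Wasserstein

/-! ### Lower bounds for Lipschitz generators -/

/-- A `K`-Lipschitz function on `[0,1]` stays within `K / 2` of its value at the midpoint. -/
lemma exists_pushUnif_mem_closedBall {K : ℝ≥0} {G : I → ℝ} (hG : G ∈ lipClass K) :
    ∃ c : ℝ, ∀ᵐ x ∂pushUnif G, x ∈ Metric.closedBall c (K / 2) := by
  have hG : LipschitzWith K G := hG
  obtain ⟨m, hm⟩ : ∃ m : I, (m : ℝ) = 1 / 2 := ⟨⟨1 / 2, mem_Icc.2 (by norm_num)⟩, rfl⟩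
  refine ⟨G m, ?_⟩
  refine (ae_map_iff hG.continuous.measurable.aemeasurable
    Metric.isClosed_closedBall.measurableSet).2 ?_
  refine ae_of_all _ fun x => ?_
  refine (hG.dist_le_mul _ _).trans ?_
  have hx : dist x m ≤ 1 / 2 := by
    rw [Subtype.dist_eq, Real.dist_eq, hm, abs_le]
    constructor <;> linarith [x.2.1, x.2.2]
  calc (K : ℝ) * _ ≤ K * (1 / 2) := by gcongr
    _ = K / 2 := by ring

/-- If `F` is `K₁`-Lipschitz and `K K₁ < 1`, an interval slightly longer than `K` cannot carry the
whole mass of `μ`. -/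
lemma exists_pos_le_W1_of_lipschitz_cdf {μ : Measure ℝ} [IsProbabilityMeasure μ] {K K₁ : ℝ≥0}
    (hK₁ : 0 < K₁) (hF : LipschitzWith K₁ (cdf μ)) (hK : K < 1 / K₁) :
    ∃ δ : ℝ≥0∞, 0 < δ ∧ ∀ G ∈ lipClass K, δ ≤ W1 (pushUnif G) μ := by
  have hK₁' : (0 : ℝ) < K₁ := hK₁
  have hKK : (K : ℝ) * K₁ < 1 := by exact_mod_cast (lt_div_iff₀ hK₁).1 hK
  -- With this margin `ε` the mass left outside is at least `1 - K₁ (K + 2 ε) = (1 - K K₁) / 2`.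
  set ε : ℝ := (1 - K * K₁) / (4 * K₁) with hε
  have hε0 : 0 < ε := div_pos (by linarith) (by linarith)
  have hεK : 4 * (K₁ * ε) = 1 - K * K₁ := by rw [hε]; field_simp
  refine ⟨ENNReal.ofReal ε * ENNReal.ofReal ((1 - K * K₁) / 2),
    ENNReal.mul_pos (by simpa using hε0) (by simpa using hKK), fun G hG => ?_⟩
  obtain ⟨c, hc⟩ := exists_pushUnif_mem_closedBall hG
  set r : ℝ := K / 2 + ε with hr
  refine le_trans ?_ (mul_measure_le_W1 (t := (Ioc (c - r) (c + r))ᶜ) (ε := ENNReal.ofReal ε) hc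
    measurableSet_Ioc.compl ?_)
  · gcongr
    have hI : μ (Ioc (c - r) (c + r)) ≤ ENNReal.ofReal ((1 + K * K₁) / 2) := by
      conv_lhs => rw [← measure_cdf μ]
      rw [StieltjesFunction.measure_Ioc]
      refine ENNReal.ofReal_le_ofReal ?_
      have h := hF.dist_le_mul (c + r) (c - r)
      rw [Real.dist_eq, Real.dist_eq] at h
      have hr0 : 0 ≤ r := by positivity
      rw [show c + r - (c - r) = 2 * r by ring, abs_of_nonneg (by linarith : 0 ≤ 2 * r)] at h
      have := (le_abs_self _).trans h
      nlinarith
    rw [prob_compl_eq_one_sub measurableSet_Ioc]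
    refine le_trans ?_ (tsub_le_tsub_left hI 1)
    rw [← ENNReal.ofReal_one, ← ENNReal.ofReal_sub _ (by positivity)]
    exact ENNReal.ofReal_le_ofReal (by linarith)
  · intro x hx y hy
    rw [edist_dist]
    refine ENNReal.ofReal_le_ofReal ?_
    rw [Metric.mem_closedBall, Real.dist_eq, abs_le] at hx
    rw [mem_compl_iff, mem_Ioc, not_and_or, not_lt, not_le] at hy
    rw [Real.dist_eq, le_abs]
    rcases hy with hy | hy
    · left; linarith
    · right; linarith

/-- If the support of `μ` is unbounded, two sets of positive mass are so far apart that no interval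
of length `K` is close to both. -/
lemma exists_pos_le_W1_of_unbounded_support {μ : Measure ℝ}
    (hμ : ¬ Bornology.IsBounded μ.support) (K : ℝ≥0) :
    ∃ δ : ℝ≥0∞, 0 < δ ∧ ∀ G ∈ lipClass K, δ ≤ W1 (pushUnif G) μ := by
  have hpair : ∃ x ∈ μ.support, ∃ y ∈ μ.support, (K : ℝ) + 4 < dist x y := by
    by_contra! h
    exact hμ (Metric.isBounded_iff.2 ⟨K + 4, fun x hx y hy => h x hx y hy⟩)
  obtain ⟨x, hx, y, hy, hxy⟩ := hpair
  have hpos : ∀ z ∈ μ.support, 0 < μ (Metric.closedBall z 1) := fun z hz =>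
    (Measure.mem_support_iff_forall z).1 hz _ (Metric.closedBall_mem_nhds z one_pos)
  refine ⟨min (μ (Metric.closedBall x 1)) (μ (Metric.closedBall y 1)),
    lt_min (hpos x hx) (hpos y hy), fun G hG => ?_⟩
  obtain ⟨c, hc⟩ := exists_pushUnif_mem_closedBall hG
  have key : ∀ z : ℝ, (K : ℝ) / 2 + 2 ≤ dist c z →
      μ (Metric.closedBall z 1) ≤ W1 (pushUnif G) μ := by
    intro z hz
    rw [← one_mul (μ _)]
    refine mul_measure_le_W1 hc Metric.isClosed_closedBall.measurableSet fun a ha b hb => ?_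
    rw [edist_dist, ← ENNReal.ofReal_one]
    refine ENNReal.ofReal_le_ofReal ?_
    rw [Metric.mem_closedBall] at ha hb
    linarith [dist_triangle4 c a b z, dist_comm a c]
  rcases le_or_gt ((K : ℝ) / 2 + 2) (dist c x) with h | h
  · exact (min_le_left _ _).trans (key x h)
  · refine (min_le_right _ _).trans (key y ?_)
    linarith [dist_triangle x c y, dist_comm x c]

/-- A uniform lower bound over `Lip_K` bounds the limit inferior along any choice of generators. -/
lemma ae_liminf_W1_pos {Ω : Type*} [MeasurableSpace Ω] {P : Measure Ω} {μ : Measure ℝ} {K : ℝ≥0}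
    (h : ∃ δ : ℝ≥0∞, 0 < δ ∧ ∀ G ∈ lipClass K, δ ≤ W1 (pushUnif G) μ) {G : ℕ → Ω → I → ℝ}
    (hG : ∀ n, 1 ≤ n → ∀ᵐ ω ∂P, G n ω ∈ lipClass K) :
    ∀ᵐ ω ∂P, 0 < liminf (fun n => W1 (pushUnif (G n ω)) μ) atTop := by
  obtain ⟨δ, hδ, hle⟩ := h
  have hall : ∀ᵐ ω ∂P, ∀ n, 1 ≤ n → G n ω ∈ lipClass K :=
    ae_all_iff.2 fun n => by
      by_cases hn : 1 ≤ n
      · filter_upwards [hG n hn] with ω hω _ using hω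
      · exact ae_of_all _ fun ω h => absurd h hn
  filter_upwards [hall] with ω hω
  refine hδ.trans_le (le_liminf_of_le (by isBoundedDefault) ?_)
  filter_upwards [eventually_ge_atTop 1] with n hn using hle _ (hω n hn)

/-! ### Quantile functions -/

/-- The Galois connection between the quantile function and the distribution function. -/
lemma quantileFn_le_iff (ν : Measure ℝ) {u : ℝ} (hu : u ∈ Ioo (0 : ℝ) 1) (x : ℝ) :
    quantileFn ν u ≤ x ↔ u ≤ cdf ν x := by
  have hne : {x : ℝ | u ≤ cdf ν x}.Nonempty :=
    ((tendsto_cdf_atTop ν).eventually_const_lt hu.2).exists.imp fun _ h => h.le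
  have hbdd : BddBelow {x : ℝ | u ≤ cdf ν x} := by
    obtain ⟨a, ha⟩ := ((tendsto_cdf_atBot ν).eventually_lt_const hu.1).exists
    refine ⟨a, fun y hy => le_of_not_gt fun hya => ?_⟩
    exact absurd ((hy : u ≤ cdf ν y).trans (monotone_cdf ν hya.le)) (not_le.2 ha)
  refine ⟨fun h => ?_, fun h => csInf_le hbdd h⟩
  -- Right continuity: `u ≤ F y` for every `y > x`.
  have hright : Tendsto (cdf ν) (𝓝[>] x) (𝓝 (cdf ν x)) :=
    ((cdf ν).right_continuous x).mono_left (nhdsWithin_mono _ Ioi_subset_Ici_self)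
  refine ge_of_tendsto hright ?_
  filter_upwards [self_mem_nhdsWithin] with y hy
  obtain ⟨z, hz, hzy⟩ := exists_lt_of_csInf_lt hne (h.trans_lt hy)
  exact (hz : u ≤ cdf ν z).trans (monotone_cdf ν hzy.le)

lemma monotoneOn_quantileFn (ν : Measure ℝ) : MonotoneOn (quantileFn ν) (Ioo 0 1) := by
  intro u hu v hv huv
  rw [quantileFn_le_iff ν hu]
  exact huv.trans ((quantileFn_le_iff ν hv _).1 le_rfl)

lemma aemeasurable_quantileFn (ν : Measure ℝ) :
    AEMeasurable (quantileFn ν) (volume.restrict (Ioo 0 1)) :=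
  aemeasurable_restrict_of_monotoneOn measurableSet_Ioo (monotoneOn_quantileFn ν)

/-- The quantile transform: `F⁻¹(U)` has law `ν`. -/
lemma map_quantileFn (ν : Measure ℝ) [IsProbabilityMeasure ν] :
    (volume.restrict (Ioo (0 : ℝ) 1)).map (quantileFn ν) = ν := by
  refine Measure.ext_of_Iic _ _ fun x => ?_
  rw [Measure.map_apply_of_aemeasurable (aemeasurable_quantileFn ν) measurableSet_Iic,
    Measure.restrict_apply' measurableSet_Ioo]
  have hset : quantileFn ν ⁻¹' Iic x ∩ Ioo 0 1 = Ioo 0 1 ∩ Iic (cdf ν x) := by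
    ext u
    simp only [mem_inter_iff, mem_preimage, mem_Iic]
    exact ⟨fun h => ⟨h.2, (quantileFn_le_iff ν h.2 x).1 h.1⟩,
      fun h => ⟨(quantileFn_le_iff ν h.1 x).2 h.2, h.1⟩⟩
  rw [hset, ← ofReal_cdf ν x]
  refine le_antisymm ?_ ?_
  · refine (measure_mono (t := Ioc 0 (cdf ν x)) fun u hu => ⟨hu.1.1, hu.2⟩).trans_eq ?_
    simp
  · refine le_trans (le_of_eq ?_) (measure_mono (s := Ioo 0 (cdf ν x)) fun u hu =>
      ⟨⟨hu.1, hu.2.trans_le (cdf_le_one ν x)⟩, hu.2.le⟩)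
    simp

lemma quantileFn_mem_Icc {ν : Measure ℝ} [IsProbabilityMeasure ν] {a b : ℝ}
    (h : ∀ᵐ x ∂ν, x ∈ Icc a b) {u : ℝ} (hu : u ∈ Ioo (0 : ℝ) 1) : quantileFn ν u ∈ Icc a b := by
  constructor
  · by_contra! hlt
    have h1 := (quantileFn_le_iff ν hu _).1 le_rfl
    have h0 : ν (Iic (quantileFn ν u)) = 0 := by
      refine measure_mono_null (t := (Icc a b)ᶜ) (fun x (hx : x ≤ _) hx' => ?_) h
      exact absurd (hx'.1.trans hx) (not_le.2 hlt)
    rw [cdf_eq_real, measureReal_def, h0] at h1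
    exact absurd h1 (not_le.2 hu.1)
  · rw [quantileFn_le_iff ν hu]
    have h1 : ν (Iic b) = 1 := (prob_compl_eq_zero_iff measurableSet_Iic).1
      (measure_mono_null (t := (Icc a b)ᶜ) (compl_subset_compl.2 Icc_subset_Iic_self) h)
    rw [cdf_eq_real, measureReal_def, h1]
    exact hu.2.le

/-- If `F⁻¹` is `K₀`-Lipschitz on `(0,1)`, its extension to `[0,1]` generates `μ` exactly. -/
lemma exists_pushUnif_eq {μ : Measure ℝ} [IsProbabilityMeasure μ] {K₀ : ℝ≥0}
    (h : LipschitzOnWith K₀ (quantileFn μ) (Ioo 0 1)) : ∃ G ∈ lipClass K₀, pushUnif G = μ := by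
  obtain ⟨g, hg, hgq⟩ := h.extend_real
  refine ⟨fun u => g u, ?_, ?_⟩
  · have : LipschitzWith (K₀ * 1) (g ∘ (Subtype.val : I → ℝ)) :=
      hg.comp (LipschitzWith.subtype_val _)
    rwa [mul_one] at this
  · calc pushUnif (fun u => g u) = ((volume : Measure I).map Subtype.val).map g :=
          (Measure.map_map hg.continuous.measurable measurable_subtype_coe).symm
      _ = (volume.restrict (Ioo 0 1)).map g := by
          rw [unitInterval.measurePreserving_coe.map_eq, unitInterval,
            Measure.restrict_congr_set Ioo_ae_eq_Icc.symm]
      _ = (volume.restrict (Ioo 0 1)).map (quantileFn μ) :=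
          Measure.map_congr ((ae_restrict_mem measurableSet_Ioo).mono fun u hu => (hgq hu).symm)
      _ = μ := map_quantileFn μ

/-- Convergence of the distribution functions at rational points entails convergence of the quantile
functions at every continuity point of the limit. -/
lemma tendsto_quantileFn {ν : ℕ → Measure ℝ} {μ : Measure ℝ}
    (hν : ∀ q : ℚ, Tendsto (fun n => cdf (ν n) q) atTop (𝓝 (cdf μ q)))
    {u : ℝ} (hu : u ∈ Ioo (0 : ℝ) 1) (hc : ContinuousAt (quantileFn μ) u) :
    Tendsto (fun n => quantileFn (ν n) u) atTop (𝓝 (quantileFn μ u)) := by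
  refine tendsto_order.2 ⟨fun a ha => ?_, fun b hb => ?_⟩
  · obtain ⟨q, haq, hq⟩ := exists_rat_btwn ha
    have hlt : cdf μ q < u :=
      not_le.1 fun h => absurd ((quantileFn_le_iff μ hu q).2 h) (not_le.2 hq)
    filter_upwards [(hν q).eventually_lt_const hlt] with n hn
    exact haq.trans (not_le.1 fun h => absurd ((quantileFn_le_iff (ν n) hu q).1 h) (not_le.2 hn))
  · obtain ⟨q, hq, hqb⟩ := exists_rat_btwn hb
    have hlt : u < cdf μ q := by
      by_contra! hle
      -- Otherwise the quantile function jumps over `q` at `u`.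
      have hright : Tendsto (quantileFn μ) (𝓝[>] u) (𝓝 (quantileFn μ u)) :=
        hc.tendsto.mono_left nhdsWithin_le_nhds
      refine absurd (ge_of_tendsto hright (b := (q : ℝ)) ?_) (not_le.2 hq)
      filter_upwards [Ioo_mem_nhdsGT hu.2] with v hv
      refine le_of_not_ge fun h => ?_
      exact absurd ((quantileFn_le_iff μ ⟨hu.1.trans hv.1, hv.2⟩ q).1 h)
        (not_le.2 (hle.trans_lt hv.1))
    filter_upwards [(hν q).eventually_const_lt hlt] with n hn
    exact ((quantileFn_le_iff (ν n) hu q).2 hn.le).trans_lt hqb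

/-- On a bounded interval, the quantile coupling turns convergence of the distribution functions
into convergence in `W₁`. -/
lemma tendsto_W1_of_tendsto_cdf {ν : ℕ → Measure ℝ} [∀ n, IsProbabilityMeasure (ν n)]
    {μ : Measure ℝ} [IsProbabilityMeasure μ] {a b : ℝ} (hμ : ∀ᵐ x ∂μ, x ∈ Icc a b)
    (hνab : ∀ n, ∀ᵐ x ∂ν n, x ∈ Icc a b) (hc : ContinuousOn (quantileFn μ) (Ioo 0 1))
    (hν : ∀ q : ℚ, Tendsto (fun n => cdf (ν n) q) atTop (𝓝 (cdf μ q))) :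
    Tendsto (fun n => W1 (ν n) μ) atTop (𝓝 0) := by
  have hle : ∀ n, W1 (ν n) μ ≤
      ∫⁻ u in Ioo (0 : ℝ) 1, edist (quantileFn (ν n) u) (quantileFn μ u) := by
    intro n
    have h := W1_map_le (aemeasurable_quantileFn (ν n)) (aemeasurable_quantileFn μ)
    rwa [map_quantileFn, map_quantileFn] at h
  refine tendsto_of_tendsto_of_tendsto_of_le_of_le tendsto_const_nhds ?_ (fun _ => zero_le) hle
  rw [show (0 : ℝ≥0∞) = ∫⁻ _ in Ioo (0 : ℝ) 1, 0 by simp]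
  refine tendsto_lintegral_of_dominated_convergence' (fun _ => ENNReal.ofReal (b - a))
    (fun n => (aemeasurable_quantileFn (ν n)).edist (aemeasurable_quantileFn μ)) (fun n => ?_)
    (by simp) ?_
  · filter_upwards [ae_restrict_mem measurableSet_Ioo] with u hu
    rw [edist_dist]
    exact ENNReal.ofReal_le_ofReal
      (Real.dist_le_of_mem_Icc (quantileFn_mem_Icc (hνab n) hu) (quantileFn_mem_Icc hμ hu))
  · filter_upwards [ae_restrict_mem measurableSet_Ioo] with u hu
    rw [← edist_self (quantileFn μ u)]
    exact (tendsto_quantileFn hν hu (hc.continuousAt (Ioo_mem_nhds hu.1 hu.2))).edist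
      tendsto_const_nhds

/-! ### Empirical measures -/

lemma isProbabilityMeasure_empiricalMeasure {E : Type*} [MeasurableSpace E] (x : ℕ → E) {n : ℕ}
    (hn : n ≠ 0) : IsProbabilityMeasure (empiricalMeasure x n) := by
  refine ⟨?_⟩
  simp only [empiricalMeasure, Measure.smul_apply, Measure.coe_finsetSum, Finset.sum_apply,
    measure_univ, Finset.sum_const, Finset.card_range, smul_eq_mul, nsmul_eq_mul, mul_one]
  exact ENNReal.inv_mul_cancel (by simpa using hn) (by simp)

lemma empiricalMeasure_real_apply {E : Type*} [MeasurableSpace E] (x : ℕ → E) (n : ℕ) {s : Set E}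
    (hs : MeasurableSet s) :
    (empiricalMeasure x n).real s =
      (∑ i ∈ Finset.range n, s.indicator (fun _ => (1 : ℝ)) (x i)) / n := by
  rw [measureReal_def, empiricalMeasure, Measure.smul_apply, Measure.coe_finsetSum,
    Finset.sum_apply, smul_eq_mul, ENNReal.toReal_mul, ENNReal.toReal_sum (fun i _ => by simp),
    ENNReal.toReal_inv, ENNReal.toReal_natCast, div_eq_inv_mul]
  congr 1
  refine Finset.sum_congr rfl fun i _ => ?_
  rw [Measure.dirac_apply' _ hs]
  by_cases h : x i ∈ s <;> simp [h]

lemma ae_mem_empiricalMeasure {E : Type*} [MeasurableSpace E] {x : ℕ → E} {s : Set E}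
    (hs : MeasurableSet s) (hx : ∀ i, x i ∈ s) (n : ℕ) : ∀ᵐ y ∂empiricalMeasure x n, y ∈ s := by
  change empiricalMeasure x n sᶜ = 0
  simp [empiricalMeasure, Measure.dirac_apply' _ hs.compl, hx]

/-- The strong law of large numbers for the frequency of a fixed event. -/
lemma ae_tendsto_empiricalMeasure_real {Ω E : Type*} [MeasurableSpace Ω] [MeasurableSpace E]
    {P : Measure Ω} [IsProbabilityMeasure P] {μ : Measure E} {X : ℕ → Ω → E}
    (hX : ∀ i, HasLaw (X i) μ P) (hindep : iIndepFun X P) {s : Set E} (hs : MeasurableSet s) :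
    ∀ᵐ ω ∂P, Tendsto (fun n => (empiricalMeasure (fun i => X i ω) n).real s) atTop
      (𝓝 (μ.real s)) := by
  set f : E → ℝ := s.indicator fun _ => 1 with hf
  have hfm : Measurable f := measurable_const.indicator hs
  have hident : ∀ i, IdentDistrib (X i) (X 0) P P := fun i =>
    ⟨(hX i).aemeasurable, (hX 0).aemeasurable, (hX i).map_eq.trans (hX 0).map_eq.symm⟩
  have hfin : IsFiniteMeasure μ := (hX 0).map_eq ▸ inferInstance
  have hint : Integrable (f ∘ X 0) P := by
    refine Integrable.comp_aemeasurable ?_ (hX 0).aemeasurable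
    rw [(hX 0).map_eq]
    exact (integrable_const (1 : ℝ)).indicator hs
  have hmean : P[f ∘ X 0] = μ.real s := by
    have h := integral_map (hX 0).aemeasurable (hfm.aestronglyMeasurable (μ := P.map (X 0)))
    rw [(hX 0).map_eq] at h
    exact h.symm.trans (integral_indicator_one hs)
  have h := strong_law_ae_real (fun i => f ∘ X i) hint
    (fun i j hij => (hindep.indepFun hij).comp hfm hfm) (fun i => (hident i).comp hfm)
  filter_upwards [h] with ω hω
  rw [← hmean]
  refine hω.congr fun n => ?_
  rw [empiricalMeasure_real_apply _ _ hs]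
  rfl

/-- Almost sure convergence of the empirical measures in `W₁`, for a law with bounded support and
continuous quantile function. -/
lemma ae_tendsto_W1_empiricalMeasure {Ω : Type*} [MeasurableSpace Ω] {P : Measure Ω}
    [IsProbabilityMeasure P] {μ : Measure ℝ} [IsProbabilityMeasure μ] {X : ℕ → Ω → ℝ}
    (hX : ∀ i, HasLaw (X i) μ P) (hindep : iIndepFun X P) (hb : Bornology.IsBounded μ.support)
    (hc : ContinuousOn (quantileFn μ) (Ioo 0 1)) :
    ∀ᵐ ω ∂P, Tendsto (fun n => W1 (empiricalMeasure (fun i => X i ω) n) μ) atTop (𝓝 0) := by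
  obtain ⟨R, hR⟩ := hb.subset_closedBall 0
  rw [Real.closedBall_eq_Icc] at hR
  have hμR : ∀ᵐ x ∂μ, x ∈ Icc (0 - R) (0 + R) := mem_of_superset Measure.support_mem_ae hR
  have hXR : ∀ᵐ ω ∂P, ∀ i, X i ω ∈ Icc (0 - R) (0 + R) := ae_all_iff.2 fun i => by
    rw [← (hX i).map_eq] at hμR
    exact ae_of_ae_map (hX i).aemeasurable hμR
  have hcdf : ∀ᵐ ω ∂P, ∀ q : ℚ, Tendsto
      (fun n => (empiricalMeasure (fun i => X i ω) n).real (Iic (q : ℝ))) atTop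
      (𝓝 (μ.real (Iic (q : ℝ)))) :=
    ae_all_iff.2 fun q => ae_tendsto_empiricalMeasure_real hX hindep measurableSet_Iic
  filter_upwards [hXR, hcdf] with ω hω hωF
  -- The empirical measure of no points at all is not a probability measure.
  refine (tendsto_add_atTop_iff_nat 1).1 ?_
  have (n : ℕ) : IsProbabilityMeasure (empiricalMeasure (fun i => X i ω) (n + 1)) :=
    isProbabilityMeasure_empiricalMeasure _ n.succ_ne_zero
  refine tendsto_W1_of_tendsto_cdf hμR
    (fun n => ae_mem_empiricalMeasure measurableSet_Icc hω (n + 1)) hc fun q => ?_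
  simp only [cdf_eq_real]
  exact (tendsto_add_atTop_iff_nat 1).2 (hωF q)

/-! ### Minimizers -/

/-- If `μ` is generated by some element of `Lip_K`, a minimizer is no farther from the data `ν`
than `μ` is. -/
lemma W1_pushUnif_le_of_mem_wganMinimizers {μ ν : Measure ℝ} [IsFiniteMeasure ν] {K : ℝ≥0}
    (hμ : ∃ G₀ ∈ lipClass K, pushUnif G₀ = μ) {G : I → ℝ} (hG : G ∈ wganMinimizers K ν) :
    W1 (pushUnif G) μ ≤ 2 * W1 ν μ := by
  obtain ⟨G₀, hG₀, rfl⟩ := hμ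
  calc W1 (pushUnif G) (pushUnif G₀) ≤ W1 (pushUnif G) ν + W1 ν (pushUnif G₀) := W1_triangle _ _ _
    _ ≤ W1 (pushUnif G₀) ν + W1 ν (pushUnif G₀) := by
      gcongr
      rw [hG.2]
      exact iInf₂_le G₀ hG₀
    _ = 2 * W1 ν (pushUnif G₀) := by rw [W1_comm (pushUnif G₀), two_mul]

theorem mainTheorem4 {Ω : Type*} [MeasurableSpace Ω] (P : Measure Ω) [IsProbabilityMeasure P]
    (μ : Measure ℝ) [IsProbabilityMeasure μ] (hμ : Integrable (fun x : ℝ => x) μ)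
    (X : ℕ → Ω → ℝ) (hX : ∀ i, HasLaw (X i) μ P) (hindep : iIndepFun X P) :
    (Bornology.IsBounded μ.support →
      (∀ K₀ : ℝ≥0, 0 < K₀ → LipschitzOnWith K₀ (quantileFn μ) (Ioo 0 1) →
        ∀ K : ℝ≥0, K₀ ≤ K → ∀ G : ℕ → Ω → (I → ℝ),
          (∀ n, 1 ≤ n → ∀ᵐ ω ∂P,
            G n ω ∈ wganMinimizers K (empiricalMeasure (fun i => X i ω) n)) →
          ∀ᵐ ω ∂P, Tendsto (fun n => W1 (pushUnif (G n ω)) μ) atTop (𝓝 0)) ∧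
      (∀ K₁ : ℝ≥0, 0 < K₁ → LipschitzWith K₁ (cdf μ) →
        ∀ K : ℝ≥0, 0 < K → K < 1 / K₁ → ∀ G : ℕ → Ω → (I → ℝ),
          (∀ n, 1 ≤ n → ∀ᵐ ω ∂P,
            G n ω ∈ wganMinimizers K (empiricalMeasure (fun i => X i ω) n)) →
          ∀ᵐ ω ∂P, 0 < liminf (fun n => W1 (pushUnif (G n ω)) μ) atTop)) ∧
    (¬ Bornology.IsBounded μ.support →
      ∀ K : ℝ≥0, 0 < K → ∀ G : ℕ → Ω → (I → ℝ),
        (∀ n, 1 ≤ n → ∀ᵐ ω ∂P,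
          G n ω ∈ wganMinimizers K (empiricalMeasure (fun i => X i ω) n)) →
        ∀ᵐ ω ∂P, 0 < liminf (fun n => W1 (pushUnif (G n ω)) μ) atTop) := by
  refine ⟨fun hb => ⟨fun K₀ _ hq K hK G hG => ?_, fun K₁ hK₁ hF K _ hK G hG => ?_⟩,
    fun hb K _ G hG => ?_⟩
  · have hμG : ∃ G₀ ∈ lipClass K, pushUnif G₀ = μ := by
      obtain ⟨G₀, hG₀, h⟩ := exists_pushUnif_eq hq
      exact ⟨G₀, LipschitzWith.weaken hG₀ hK, h⟩
    have hGall : ∀ᵐ ω ∂P, ∀ n : ℕ,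
        G (n + 1) ω ∈ wganMinimizers K (empiricalMeasure (fun i => X i ω) (n + 1)) :=
      ae_all_iff.2 fun n => hG (n + 1) n.succ_pos
    filter_upwards [hGall, ae_tendsto_W1_empiricalMeasure hX hindep hb hq.continuousOn]
      with ω hω hlim
    refine (tendsto_add_atTop_iff_nat 1).1 ?_
    have hlim' := ENNReal.Tendsto.const_mul (a := 2) ((tendsto_add_atTop_iff_nat 1).2 hlim)
      (Or.inr (by simp))
    rw [mul_zero] at hlim'
    refine tendsto_of_tendsto_of_tendsto_of_le_of_le tendsto_const_nhds hlim' (fun _ => zero_le)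
      fun n => ?_
    have := isProbabilityMeasure_empiricalMeasure (fun i => X i ω) n.succ_ne_zero
    exact W1_pushUnif_le_of_mem_wganMinimizers hμG (hω n)
  · exact ae_liminf_W1_pos (exists_pos_le_W1_of_lipschitz_cdf hK₁ hF hK)
      fun n hn => (hG n hn).mono fun ω h => h.1
  · exact ae_liminf_W1_pos (exists_pos_le_W1_of_unbounded_support hb K)
      fun n hn => (hG n hn).mono fun ω h => h.1
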